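/- **Setting.** Consider $M$ agents with states $x_i\in\mathbb{R}^{n_i}$ and dynamics $$\dot x_i=f_i(x_i,t)+g_i(x_i,t)u_i+c_i(x,t),\qquad i\in\mathcal V=\{1,\dots,M\},\qquad (1)$$ where $x=(x_1,\dots,x_M)\in\mathbb{R}^n$, $n=n_1+\dots+n_M$, and $f_i,g_i,c_i$ are locally Lipschitz continuous on their domains (with $t\ge 0$). Let $\mathcal V$ be partitioned into disjoint sets $\mathcal V_1,\dots,\mathcal V_K$, let $\bar x_k\in\mathbb{R}^{\bar n_k}$ be the stacked state of the agents in $\mathcal V_k$, and let each agent $i\in\mathcal V_k$ use a control law $u_i(\bar x_k,t)$. Write $\bar f_k,\bar u_k$ for the stacked vectors of the $f_i,u_i$ and $\bar g_k$ for the block-diagonal matrix of the $g_i$, $i\in\mathcal V_k$. Fix $C\ge 0$. For $h(v,t)$ let $F[h](v,t)=\bigcap_{\delta>0}\bigcap_{|N|=0}\overline{\mathrm{co}}\,h(B(v,\delta)\setminus N,t)$ be the Filippov set-valued map ($N$ ranges over Lebesgue null sets). A Filippov solution to $\dot v=h(v,t)$ is an absolutely continuous $v:[t_0,t_1]\to\mathbb{R}^d$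 with $\dot v(t)\in F[h](v(t),t)$ for almost all $t\in[t_0,t_1]$. For differentiable $\mathfrak b(v,t)$ let $\mathcal L_{F[h]}\mathfrak b(v,t)=\{\frac{\partial \mathfrak b}{\partial v}(v,t)\,\zeta+\frac{\partial \mathfrak b}{\partial t}(v,t) : \zeta\in F[h](v,t)\}$. An extended class $\mathcal K$ function is a locally Lipschitz continuous, strictly increasing $\alpha:\mathbb{R}\to\mathbb{R}$ with $\alpha(0)=0$. Fix $k$ and $0\le s_j<s_{j+1}$. Let $\bar{\mathfrak b}_k:\mathbb{R}^{\bar n_k}\times\mathbb{R}_{\ge0}\to\mathbb{R}$ be continuous on $\mathbb{R}^{\bar n_k}\times[s_j,s_{j+1})$ and continuously differentiable on $\mathbb{R}^{\bar n_k}\times(s_j,s_{j+1})$, and let $\mathfrak C_k(t)=\{\bar x_k : \bar{\mathfrak b}_k(\bar x_k,t)\ge 0\}$. * $\bar{\mathfrak b}_k$ is a *candidate control barrier function (cCBF)* for $[s_j,s_{j+1})$ if for each $\xi\in\mathfrak C_k(s_j)$ there is a (locally) absolutely continuous $y:[s_j,s_{j+1})\to\mathbb{R}^{\bar n_k}$ with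 $y(s_j)=\xi$ and $y(t)\in\mathfrak C_k(t)$ for all $t\in[s_j,s_{j+1})$. * A cCBF $\bar{\mathfrak b}_k$ is a *valid control barrier function (vCBF)* for $[s_j,s_{j+1})$ and for (1) under the control laws $u_i$ if, for all couplings $c_i$ as in (1) with $\|c_i(x,t)\|_\infty\le C$ for all $(x,t)$ and all $i\in\mathcal V_k$, every Filippov solution $x:[s_j,t_{j+1}]\to\mathbb{R}^n$ to (1) under the control laws with $\bar x_k(s_j)\in\mathfrak C_k(s_j)$ satisfies $\bar x_k(t)\in\mathfrak C_k(t)$ for all $t\in[s_j,\min(t_{j+1},s_{j+1}))$. **Theorem.** Let $\bar{\mathfrak b}_k$ be a cCBF for $[s_j,s_{j+1})$ and let $\mathfrak D_k\subseteq\mathbb{R}^{\bar n_k}$ be an open set with $\mathfrak C_k(t)\subseteq\mathfrak D_k$ for all $t\in[s_j,s_{j+1})$. If each $u_i$ is locally bounded and measurable and if there is an extended class $\mathcal K$ function $\alpha_k$ such that $$\min \mathcal L_{F[\bar f_k+\bar g_k\bar u_k]}\bar{\mathfrak b}_k(\bar x_k,t)\ \ge\ -\alpha_k(\bar{\mathfrak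 b}_k(\bar x_k,t))+\Big\|\frac{\partial\bar{\mathfrak b}_k}{\partial\bar x_k}(\bar x_k,t)\Big\|_1 C$$ for all $(\bar x_k,t)\in\mathfrak D_k\times(s_j,s_{j+1})$, then $\bar{\mathfrak b}_k$ is a vCBF for $[s_j,s_{j+1})$ and for (1) under the control laws $u_i$. -/

import Mathlib

open Set Filter Topology MeasureTheory

/-! ### Discontinuous systems

Time-dependent functions on `ℝ^d × ℝ_{≥0}` are written as functions of a real time `t`; only their
values for `t ≥ 0` are ever used or constrained. -/

/-- `f(v, t)` is locally bounded on `E × ℝ_{≥0}`. -/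
def LocBounded {E F : Type*} [NormedAddCommGroup E] [NormedAddCommGroup F]
    (f : E → ℝ → F) : Prop :=
  ∀ p ∈ (univ ×ˢ Ici 0 : Set (E × ℝ)), ∃ R : ℝ,
    ∀ᶠ q in 𝓝[univ ×ˢ Ici 0] p, ‖f q.1 q.2‖ ≤ R

/-- `f(v, t)` is Lebesgue measurable on `E × ℝ_{≥0}`. -/
def LebMeasurable {E F : Type*} [MeasureSpace E] [MeasurableSpace F]
    (f : E → ℝ → F) : Prop :=
  NullMeasurable (fun p : E × ℝ => f p.1 p.2)
    ((volume : Measure (E × ℝ)).restrict (univ ×ˢ Ici 0))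

/-- `f(v, t)` is locally Lipschitz continuous on `E × ℝ_{≥0}`. -/
def LocLipschitz {E F : Type*} [NormedAddCommGroup E] [NormedAddCommGroup F]
    (f : E → ℝ → F) : Prop :=
  LocallyLipschitzOn (univ ×ˢ Ici 0 : Set (E × ℝ)) (fun p => f p.1 p.2)

/-- The Filippov set-valued map `F[f](v, t)`, the intersection, over all `δ > 0` and all Lebesgue
null sets `N`, of the closed convex hulls of `f(B(v, δ) \ N, t)`. -/
def filippovMap {E : Type*} [NormedAddCommGroup E] [NormedSpace ℝ E] [MeasureSpace E]
    (f : E → ℝ → E) (v : E) (t : ℝ) : Set E :=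
  ⋂ (δ : ℝ) (_ : 0 < δ) (N : Set E) (_ : volume N = 0),
    closure (convexHull ℝ ((fun w => f w t) '' (Metric.ball v δ \ N)))

/-- `v` is a Filippov solution to `v' = f(v, t)` on `[t₀, t₁]`. -/
def IsFilippovSolution {E : Type*} [NormedAddCommGroup E] [NormedSpace ℝ E] [MeasureSpace E]
    (f : E → ℝ → E) (v : ℝ → E) (t₀ t₁ : ℝ) : Prop :=
  t₀ ≤ t₁ ∧ AbsolutelyContinuousOnInterval v t₀ t₁ ∧
    ∀ᵐ t ∂((volume : Measure ℝ).restrict (Icc t₀ t₁)),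
      ∃ ζ ∈ filippovMap f (v t) t, HasDerivAt v ζ t

/-- The set-valued Lie derivative of `b(v, t)` with respect to `F[f]`: all numbers
`∂b/∂v · ζ + ∂b/∂t` with `ζ ∈ F[f](v, t)`. -/
def lieDerivative {E : Type*} [NormedAddCommGroup E] [NormedSpace ℝ E] [MeasureSpace E]
    (f : E → ℝ → E) (b : E → ℝ → ℝ) (v : E) (t : ℝ) : Set ℝ :=
  {a | ∃ ζ ∈ filippovMap f v t,
    a = fderiv ℝ (fun w => b w t) v ζ + deriv (fun τ => b v τ) t}

/-- Extended class `𝒦` functions. -/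
structure IsExtendedClassK (α : ℝ → ℝ) : Prop where
  locallyLipschitz : LocallyLipschitz α
  strictMono : StrictMono α
  map_zero : α 0 = 0

/-! ### Coupled multi-agent systems

Agent `i : Fin M` has state space `ℝ^{n i}` (with the max norm, the norm of `Fin (n i) → ℝ`) and
input space `ℝ^{m i}`. The agents are partitioned into `K` disjoint groups `V_1, …, V_K`;
`cl i` is the index of the group of agent `i`, so `V_k = {i // cl i = k}`. -/

/-- The stacked state `x` of all agents. -/
abbrev FullState {M : ℕ} (n : Fin M → ℕ) : Type :=
  (i : Fin M) → Fin (n i) → ℝ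

/-- The stacked state `x̄_k` of the agents in `V_k`. -/
abbrev GroupState {M K : ℕ} (n : Fin M → ℕ) (cl : Fin M → Fin K) (k : Fin K) : Type :=
  (i : {i : Fin M // cl i = k}) → Fin (n i) → ℝ

/-- The part `x̄_k` of the full state `x`. -/
def groupPart {M K : ℕ} {n : Fin M → ℕ} (cl : Fin M → Fin K) (k : Fin K) (x : FullState n) :
    GroupState n cl k :=
  fun i => x i

/-- Drift terms `f_i(x_i, t)`, one for each agent. -/
abbrev Drift {M : ℕ} (n : Fin M → ℕ) : Type :=
  (i : Fin M) → (Fin (n i) → ℝ) → ℝ → (Fin (n i) → ℝ)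

/-- Input matrices `g_i(x_i, t)`, one for each agent. -/
abbrev InputMap {M : ℕ} (n m : Fin M → ℕ) : Type :=
  (i : Fin M) → (Fin (n i) → ℝ) → ℝ → Matrix (Fin (n i)) (Fin (m i)) ℝ

/-- Coupling terms `c_i(x, t)`, one for each agent. -/
abbrev Coupling {M : ℕ} (n : Fin M → ℕ) : Type :=
  (i : Fin M) → FullState n → ℝ → (Fin (n i) → ℝ)

/-- Control laws: each agent `i` in `V_k` uses `u_i(x̄_k, t)`. -/
abbrev ControlLaws {M K : ℕ} (n m : Fin M → ℕ) (cl : Fin M → Fin K) : Type :=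
  (k : Fin K) → (i : {i : Fin M // cl i = k}) → GroupState n cl k → ℝ → (Fin (m i) → ℝ)

/-- The closed loop of all agents: the right-hand side of
`x_i' = f_i(x_i, t) + g_i(x_i, t) u_i(x̄_k, t) + c_i(x, t)`, where `i ∈ V_k`. -/
def closedLoop {M K : ℕ} {n m : Fin M → ℕ} (cl : Fin M → Fin K) (f : Drift n)
    (g : InputMap n m) (u : ControlLaws n m cl) (c : Coupling n) :
    FullState n → ℝ → FullState n :=
  fun x t i =>
    f i (x i) t + (g i (x i) t).mulVec (u (cl i) ⟨i, rfl⟩ (groupPart cl (cl i) x) t) + c i x t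

/-- The uncoupled closed loop `f̄_k + ḡ_k ū_k` of the agents in `V_k`. -/
def nominalLoop {M K : ℕ} {n m : Fin M → ℕ} (cl : Fin M → Fin K) (f : Drift n)
    (g : InputMap n m) (u : ControlLaws n m cl) (k : Fin K) :
    GroupState n cl k → ℝ → GroupState n cl k :=
  fun y t i => f i (y i) t + (g i (y i) t).mulVec (u k i y t)

/-- The sum norm `‖∂b/∂x̄_k‖₁` of the row vector of partial derivatives of `b` in `x̄_k`. -/
noncomputable def gradNormOne {M K : ℕ} {n : Fin M → ℕ} {cl : Fin M → Fin K} {k : Fin K}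
    (b : GroupState n cl k → ℝ → ℝ) (y : GroupState n cl k) (t : ℝ) : ℝ :=
  ∑ i : {i : Fin M // cl i = k}, ∑ l : Fin (n i),
    |fderiv ℝ (fun z => b z t) y (Pi.single i (Pi.single l 1))|

/-! ### Control barrier functions -/

/-- The superlevel set `C(t) = {v | b(v, t) ≥ 0}`. -/
def superlevel {E : Type*} (b : E → ℝ → ℝ) (t : ℝ) : Set E := {v | 0 ≤ b v t}

/-- `b` is a candidate control barrier function for `[s, s')`: from every point of `C(s)` there
starts a (locally) absolutely continuous curve on `[s, s')` that stays in `C(t)`. -/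
def IsCandidateCBF {E : Type*} [NormedAddCommGroup E] (b : E → ℝ → ℝ) (s s' : ℝ) : Prop :=
  ∀ v₀ ∈ superlevel b s, ∃ v : ℝ → E, v s = v₀ ∧
    (∀ T, s ≤ T → T < s' → AbsolutelyContinuousOnInterval v s T) ∧
    ∀ t ∈ Ico s s', v t ∈ superlevel b t

/-- `b` is a valid control barrier function for `[s, s')` and for the multi-agent system under the
control laws `u`, with bound `C` on the couplings of the agents in `V_k`. -/
def IsValidCBF {M K : ℕ} {n m : Fin M → ℕ} (cl : Fin M → Fin K) (f : Drift n)
    (g : InputMap n m) (C : ℝ) (u : ControlLaws n m cl) (k : Fin K)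
    (b : GroupState n cl k → ℝ → ℝ) (s s' : ℝ) : Prop :=
  IsCandidateCBF b s s' ∧
  ∀ c : Coupling n, (∀ i, LocLipschitz (c i)) →
    (∀ i, cl i = k → ∀ x t, 0 ≤ t → ‖c i x t‖ ≤ C) →
    ∀ (t₁ : ℝ) (x : ℝ → FullState n), IsFilippovSolution (closedLoop cl f g u c) x s t₁ →
      groupPart cl k (x s) ∈ superlevel b s →
      ∀ t ∈ Ico s (min t₁ s'), groupPart cl k (x t) ∈ superlevel b t

/-! Along a solution put `φ t = b (y t) t`, with `y` the group's part of the state. If `φ` became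
negative, consider the last earlier time `τ` with `φ τ = 0`. Since `y τ` lies in the open set `D`,
so does `y` shortly after `τ`. There the barrier condition gives `φ' ≥ -α φ > 0` almost everywhere
while `φ < 0`, so `φ` cannot have decreased from zero (`nonneg_of_le_of_neg_right`).

Two facts give this derivative bound. Subtracting the coupling from the group's velocity leaves an
element of the nominal Filippov map, because the coupling is continuous in the state
(`map_sub_mem_filippovMap`). The coupling then changes `φ'` by at most `gradNormOne * C`, by
`ℓ¹`-`ℓ^∞` duality, which is exactly the margin in the barrier condition. -/

/-! ### Absolutely continuous functions -/

namespace AbsolutelyContinuousOnInterval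

theorem comp_lipschitzOnWith {X Y : Type*} [PseudoMetricSpace X] [PseudoMetricSpace Y]
    {φ : X → Y} {L : NNReal} {S : Set X} (hφ : LipschitzOnWith L φ S) {v : ℝ → X} {a b : ℝ}
    (hv : AbsolutelyContinuousOnInterval v a b) (hS : MapsTo v (uIcc a b) S) :
    AbsolutelyContinuousOnInterval (fun t => φ (v t)) a b := by
  have hlim := Tendsto.const_mul (L : ℝ) hv
  rw [mul_zero] at hlim
  refine squeeze_zero' (.of_forall fun E => Finset.sum_nonneg fun _ _ => dist_nonneg) ?_ hlim
  refine eventually_inf_principal.2 (.of_forall fun E hE => ?_)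
  rw [Finset.mul_sum]
  exact Finset.sum_le_sum fun i hi =>
    hφ.dist_le_mul _ (hS (hE.1 i hi).1) _ (hS (hE.1 i hi).2)

theorem prodMk {X Y : Type*} [PseudoMetricSpace X] [PseudoMetricSpace Y]
    {v : ℝ → X} {w : ℝ → Y} {a b : ℝ} (hv : AbsolutelyContinuousOnInterval v a b)
    (hw : AbsolutelyContinuousOnInterval w a b) :
    AbsolutelyContinuousOnInterval (fun t => (v t, w t)) a b := by
  have hlim := Tendsto.add hv hw
  rw [add_zero] at hlim
  refine squeeze_zero (fun E => Finset.sum_nonneg fun _ _ => dist_nonneg) (fun E => ?_) hlim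
  rw [← Finset.sum_add_distrib]
  exact Finset.sum_le_sum fun i _ => max_le_add_of_nonneg dist_nonneg dist_nonneg

/-- By the fundamental theorem of calculus for absolutely continuous functions, a sign of the
derivative almost everywhere suffices. -/
theorem le_of_ae_hasDerivAt_nonneg {φ : ℝ → ℝ} {a b : ℝ} (hab : a ≤ b)
    (hφ : AbsolutelyContinuousOnInterval φ a b)
    (hderiv : ∀ᵐ t ∂(volume.restrict (Icc a b)), ∃ r, 0 ≤ r ∧ HasDerivAt φ r t) :
    φ a ≤ φ b := by
  rw [← sub_nonneg, ← hφ.integral_deriv_eq_sub]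
  refine intervalIntegral.integral_nonneg_of_ae_restrict hab ?_
  filter_upwards [hderiv] with t ht
  obtain ⟨r, hr, hd⟩ := ht
  simpa [hd.deriv] using hr

/-- A `C¹` function is absolutely continuous along an absolutely continuous curve. -/
theorem comp_contDiffOn {E : Type*} [NormedAddCommGroup E] [NormedSpace ℝ E] [ProperSpace E]
    {b : E → ℝ → ℝ} {s s' : ℝ}
    (hb : ContDiffOn ℝ 1 (fun p : E × ℝ => b p.1 p.2) (univ ×ˢ Ioo s s'))
    {y : ℝ → E} {a c : ℝ} (hac : a ≤ c) (hsub : Icc a c ⊆ Ioo s s')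
    (hy : AbsolutelyContinuousOnInterval y a c) :
    AbsolutelyContinuousOnInterval (fun t => b (y t) t) a c := by
  obtain ⟨R, hR⟩ := hy.exists_bound
  -- The curve stays in a closed ball; a `C¹` function is Lipschitz on the compact convex product of
  -- this ball with `[a, c]`.
  obtain ⟨L, hL⟩ := (hb.mono
    (prod_mono (subset_univ (Metric.closedBall 0 R)) hsub)).exists_lipschitzOnWith one_ne_zero
    ((convex_closedBall _ _).prod (convex_Icc _ _))
    ((isCompact_closedBall _ _).prod isCompact_Icc)
  have hid : AbsolutelyContinuousOnInterval (fun t : ℝ => t) a c :=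
    LipschitzOnWith.absolutelyContinuousOnInterval (K := 1)
      (LipschitzWith.id.lipschitzOnWith)
  refine (hy.prodMk hid).comp_lipschitzOnWith hL fun t ht => ⟨?_, ?_⟩
  · simpa using hR t ht
  · simpa [uIcc_of_le hac] using ht

end AbsolutelyContinuousOnInterval

/-- A continuous function on `[s, T)` that starts nonnegative stays nonnegative if, after each of
its zeros, it does not decrease as long as it is negative. -/
theorem nonneg_of_le_of_neg_right {φ : ℝ → ℝ} {s T : ℝ} (hφ : ContinuousOn φ (Ico s T))
    (h₀ : 0 ≤ φ s)
    (hloc : ∀ τ ∈ Ico s T, φ τ = 0 → ∃ ε > 0, ∀ a c, τ < a → a ≤ c → c < τ + ε → c < T →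
      (∀ t ∈ Icc a c, φ t < 0) → φ a ≤ φ c) :
    ∀ t ∈ Ico s T, 0 ≤ φ t := by
  intro t₀ ht₀
  by_contra! hneg
  have hc : ContinuousOn φ (Icc s t₀) :=
    hφ.mono fun t ht => ⟨ht.1, ht.2.trans_lt ht₀.2⟩
  have hcompact : IsCompact (Icc s t₀ ∩ φ ⁻¹' Ici 0) :=
    isCompact_Icc.of_isClosed_subset (hc.preimage_isClosed_of_isClosed isClosed_Icc isClosed_Ici)
      inter_subset_left
  -- `τ` is the last time in `[s, t₀]` at which `φ` is nonnegative; continuity will force `φ τ = 0`.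
  obtain ⟨τ, ⟨hτ, hτ0⟩, hmax⟩ :=
    hcompact.exists_isGreatest ⟨s, left_mem_Icc.2 ht₀.1, h₀⟩
  have hτt : τ < t₀ := lt_of_le_of_ne hτ.2 fun h => by
    subst h; exact absurd hτ0 (not_le.2 hneg)
  have hlt : ∀ t ∈ Ioc τ t₀, φ t < 0 := fun t ht => by
    by_contra! h
    exact absurd (hmax ⟨⟨hτ.1.trans ht.1.le, ht.2⟩, h⟩) (not_le.2 ht.1)
  have hlim : Tendsto φ (𝓝[>] τ) (𝓝 (φ τ)) :=
    ((hc τ hτ).mono_of_mem_nhdsWithin (mem_of_superset (Ioc_mem_nhdsGT hτt)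
      fun t ht => ⟨hτ.1.trans ht.1.le, ht.2⟩)).tendsto
  have hτle : φ τ ≤ 0 := le_of_tendsto hlim <| by
    filter_upwards [Ioc_mem_nhdsGT hτt] with t ht using (hlt t ht).le
  obtain ⟨ε, hε, hmono⟩ := hloc τ ⟨hτ.1, hτt.trans ht₀.2⟩ (le_antisymm hτle hτ0)
  obtain ⟨c, hc1, hc2⟩ := exists_between (lt_min hτt (lt_add_of_pos_right τ hε))
  have hct : c < t₀ := hc2.trans_le (min_le_left _ _)
  -- The monotonicity is only available on `[a, c]` with `a > τ`; let `a` decrease to `τ`.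
  have hle : φ τ ≤ φ c := le_of_tendsto hlim <| by
    filter_upwards [Ioc_mem_nhdsGT hc1] with a ha
    exact hmono a c ha.1 ha.2 (hc2.trans_le (min_le_right _ _)) (hct.trans ht₀.2)
      fun t ht => hlt t ⟨ha.1.trans_le ht.1, ht.2.trans hct.le⟩
  exact absurd (hle.trans_lt (hlt c ⟨hc1, hct.le⟩)) (not_lt.2 hτ0)

/-! ### Filippov maps of coupled systems -/

/-- If a linear quotient `P` of the vector field `H` is the vector field `G` up to a continuous
perturbation `d`, then `P` maps the Filippov map of `H` into that of `G`, shifted by `d`. -/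
theorem map_sub_mem_filippovMap {E F : Type*} [NormedAddCommGroup E] [NormedSpace ℝ E]
    [MeasureSpace E] [NormedAddCommGroup F] [NormedSpace ℝ F] [MeasureSpace F]
    (P : E →L[ℝ] F) (hP : ∀ w, ‖P w‖ ≤ ‖w‖)
    (hPvol : ∀ N : Set F, volume N = 0 → volume (P ⁻¹' N) = 0)
    {H : E → ℝ → E} {G : F → ℝ → F} {d : E → F} {v : E} {t : ℝ}
    (hH : ∀ w, P (H w t) = G (P w) t + d w) (hd : ContinuousAt d v)
    {ζ : E} (hζ : ζ ∈ filippovMap H v t) :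
    P ζ - d v ∈ filippovMap G (P v) t := by
  simp only [filippovMap, mem_iInter] at hζ ⊢
  intro δ hδ N hN
  set A := convexHull ℝ ((fun w => G w t) '' (Metric.ball (P v) δ \ N)) with hA
  -- The `ε`-thickening absorbs the variation of `d` near `v`. It is closed and convex, and so is
  -- its preimage under the affine map `Q`, so it is enough to check values of `H`.
  rw [Metric.closure_eq_iInter_cthickening, mem_iInter₂]
  intro ε hε
  obtain ⟨η, hη, hdη⟩ := Metric.continuousAt_iff.1 hd ε hε
  let Q : E → F := fun w => P w - d v
  have hconv : Convex ℝ (Q ⁻¹' Metric.cthickening ε A) := by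
    have h := (((convex_convexHull ℝ _).cthickening ε : Convex ℝ (Metric.cthickening ε A)).translate
      (d v)).linear_preimage P.toLinearMap
    convert h using 1
    ext w
    simp [Q, hA, sub_eq_neg_add]
  have hclosed : IsClosed (Q ⁻¹' Metric.cthickening ε A) :=
    Metric.isClosed_cthickening.preimage (by fun_prop)
  refine closure_minimal (convexHull_min ?_ hconv) hclosed
    (hζ (min δ η) (lt_min hδ hη) (P ⁻¹' N) (hPvol N hN))
  rintro _ ⟨w, ⟨hw, hwN⟩, rfl⟩
  rw [Metric.mem_ball, lt_min_iff] at hw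
  refine Metric.mem_cthickening_of_dist_le _ (G (P w) t) ε A
    (subset_convexHull ℝ _ ⟨P w, ⟨?_, hwN⟩, rfl⟩) ?_
  · rw [Metric.mem_ball, dist_eq_norm, ← map_sub]
    exact (hP _).trans_lt (by simpa [dist_eq_norm] using hw.1)
  · have h := (hdη hw.2).le
    simpa [Q, hH, dist_eq_norm, add_sub_assoc] using h

section Groups

variable {M K : ℕ} {n m : Fin M → ℕ} (cl : Fin M → Fin K)

/-- The projection `x ↦ x̄_k` as a continuous linear map. -/
def groupPartCLM (n : Fin M → ℕ) (k : Fin K) : FullState n →L[ℝ] GroupState n cl k :=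
  ContinuousLinearMap.pi fun i => ContinuousLinearMap.proj (i : Fin M)

theorem norm_groupPart_le (k : Fin K) (x : FullState n) : ‖groupPart cl k x‖ ≤ ‖x‖ :=
  (pi_norm_le_iff_of_nonneg (norm_nonneg _)).2 fun i => norm_le_pi_norm x i

/-- By Fubini: up to a volume-preserving splitting, the projection is the first factor of a product.
-/
theorem volume_preimage_groupPart_eq_zero (k : Fin K) (N : Set (GroupState n cl k))
    (hN : volume N = 0) : volume (groupPart cl k ⁻¹' N) = 0 := by
  have h := (Measure.quasiMeasurePreserving_fst (μ := (volume : Measure (GroupState n cl k)))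
    (ν := (volume : Measure ((i : {i : Fin M // ¬ cl i = k}) → Fin (n i) → ℝ)))).comp
    (volume_preserving_piEquivPiSubtypeProd (fun i : Fin M => Fin (n i) → ℝ)
      (fun i => cl i = k)).quasiMeasurePreserving
  exact h.preimage_null hN

/-- Keeping `k` a variable lets `hi` be substituted, which avoids a transport between the types
indexed by `k` and `cl i`. -/
theorem closedLoop_apply (f : Drift n) (g : InputMap n m) (u : ControlLaws n m cl)
    (c : Coupling n) (x : FullState n) (t : ℝ) {k : Fin K} (i : Fin M) (hi : cl i = k) :
    closedLoop cl f g u c x t i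
      = nominalLoop cl f g u k (groupPart cl k x) t ⟨i, hi⟩ + c i x t := by
  subst hi
  rfl

theorem groupPart_closedLoop (f : Drift n) (g : InputMap n m) (u : ControlLaws n m cl)
    (c : Coupling n) (k : Fin K) (x : FullState n) (t : ℝ) :
    groupPart cl k (closedLoop cl f g u c x t)
      = nominalLoop cl f g u k (groupPart cl k x) t + groupPart cl k (fun i => c i x t) :=
  funext fun i => closedLoop_apply cl f g u c x t i i.2

theorem LocLipschitz.continuous_left {E F : Type*} [NormedAddCommGroup E] [NormedAddCommGroup F]
    {f : E → ℝ → F} (hf : LocLipschitz f) {t : ℝ} (ht : 0 ≤ t) : Continuous fun w => f w t :=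
  hf.continuousOn.comp_continuous (f := fun w => (w, t)) (by fun_prop) fun _ => ⟨trivial, ht⟩

theorem abs_fderiv_apply_le_gradNormOne_mul {k : Fin K} (b : GroupState n cl k → ℝ → ℝ)
    (y : GroupState n cl k) (t : ℝ) {C : ℝ} {d : GroupState n cl k} (hd : ∀ i, ‖d i‖ ≤ C) :
    |fderiv ℝ (fun z => b z t) y d| ≤ gradNormOne b y t * C := by
  set A := fderiv ℝ (fun z => b z t) y with hA
  have hsum : d = ∑ i, ∑ l, d i l • (Pi.single i (Pi.single l 1) : GroupState n cl k) := by
    ext j r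
    simp only [Finset.sum_apply, Pi.smul_apply, smul_eq_mul]
    rw [Finset.sum_eq_single j, Finset.sum_eq_single r]
    · simp
    · intro l _ hl
      simp [Pi.single_eq_of_ne hl.symm]
    · simp
    · intro i _ hi
      simp [Pi.single_eq_of_ne hi.symm]
    · simp
  conv_lhs => rw [hsum]
  simp only [map_sum, map_smul, smul_eq_mul, gradNormOne, Finset.sum_mul]
  refine (Finset.abs_sum_le_sum_abs _ _).trans (Finset.sum_le_sum fun i _ => ?_)
  refine (Finset.abs_sum_le_sum_abs _ _).trans (Finset.sum_le_sum fun l _ => ?_)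
  rw [abs_mul, mul_comm]
  exact mul_le_mul_of_nonneg_left ((norm_le_pi_norm (d i) l).trans (hd i)) (abs_nonneg _)

end Groups

/-- The chain rule for a time-dependent function along a curve. -/
theorem hasDerivAt_comp_curve {E : Type*} [NormedAddCommGroup E] [NormedSpace ℝ E]
    {b : E → ℝ → ℝ} {y : ℝ → E} {y' : E} {t : ℝ}
    (hb : DifferentiableAt ℝ (fun p : E × ℝ => b p.1 p.2) (y t, t)) (hy : HasDerivAt y y' t) :
    HasDerivAt (fun τ => b (y τ) τ)
      (fderiv ℝ (fun w => b w t) (y t) y' + deriv (fun τ => b (y t) τ) t) t := by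
  set B := fderiv ℝ (fun p : E × ℝ => b p.1 p.2) (y t, t)
  have hB : HasFDerivAt (fun p : E × ℝ => b p.1 p.2) B (y t, t) := hb.hasFDerivAt
  have h₁ : HasFDerivAt (fun w => b w t) (B.comp (ContinuousLinearMap.inl ℝ E ℝ)) (y t) :=
    hB.comp (f := fun w => (w, t)) (y t) (hasFDerivAt_prodMk_left (y t) t)
  have h₂ : HasDerivAt (fun τ => b (y t) τ) (B (0, 1)) t :=
    hB.comp_hasDerivAt (f := fun τ => (y t, τ)) t
      ((hasDerivAt_const t (y t)).prodMk (hasDerivAt_id t))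
  have h : HasDerivAt (fun τ => b (y τ) τ) (B (y', 1)) t :=
    hB.comp_hasDerivAt (f := fun τ => (y τ, τ)) t (hy.prodMk (hasDerivAt_id t))
  rw [h₁.fderiv, h₂.deriv]
  convert h using 1
  simp [← map_add]


theorem theorem1 {M K : ℕ} (n m : Fin M → ℕ) (cl : Fin M → Fin K)
    -- the agents' dynamics and the bound on the couplings
    (f : Drift n) (hf : ∀ i, LocLipschitz (f i))
    (g : InputMap n m) (hg : ∀ i l r, LocLipschitz (fun y t => g i y t l r))
    (C : ℝ) (hC : 0 ≤ C)
    -- the group, the time interval and the candidate control barrier function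
    (k : Fin K) (s s' : ℝ) (hs : 0 ≤ s) (hss' : s < s')
    (b : GroupState n cl k → ℝ → ℝ)
    (hb : ContDiffOn ℝ 1 (fun p : GroupState n cl k × ℝ => b p.1 p.2) (univ ×ˢ Ioo s s'))
    (hb_cont : ContinuousOn (fun p : GroupState n cl k × ℝ => b p.1 p.2) (univ ×ˢ Ico s s'))
    (hcand : IsCandidateCBF b s s')
    -- the open set
    (D : Set (GroupState n cl k)) (hD : IsOpen D)
    (hDC : ∀ t ∈ Ico s s', superlevel b t ⊆ D)
    -- the control laws
    (u : ControlLaws n m cl)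
    (hu_bdd : ∀ k' i, LocBounded (u k' i)) (hu_meas : ∀ k' i, LebMeasurable (u k' i))
    -- the barrier condition: every element of the set-valued Lie derivative is bounded below
    (α : ℝ → ℝ) (hα : IsExtendedClassK α)
    (hbarrier : ∀ y ∈ D, ∀ t ∈ Ioo s s', ∀ a ∈ lieDerivative (nominalLoop cl f g u k) b y t,
      -α (b y t) + gradNormOne b y t * C ≤ a) :
    IsValidCBF cl f g C u k b s s' := by

  refine ⟨hcand, fun c hc hcC t₁ x ⟨_, hxac, hxF⟩ hx₀ => ?_⟩
  set y : ℝ → GroupState n cl k := fun t => groupPart cl k (x t) with hy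
  have hyac : AbsolutelyContinuousOnInterval y s t₁ :=
    hxac.comp_lipschitzOnWith (φ := groupPartCLM cl n k)
      ((groupPartCLM cl n k).lipschitz.lipschitzOnWith (s := univ)) (mapsTo_univ _ _)
  have hIcc : ∀ {t}, t ∈ Ico s (min t₁ s') → t ∈ Icc s t₁ := fun ht =>
    ⟨ht.1, (ht.2.trans_le (min_le_left _ _)).le⟩
  have hycont : ContinuousOn y (Ico s (min t₁ s')) :=
    hyac.continuousOn.mono fun t ht => Icc_subset_uIcc (hIcc ht)
  have hφcont : ContinuousOn (fun t => b (y t) t) (Ico s (min t₁ s')) :=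
    hb_cont.comp (f := fun t => (y t, t)) (hycont.prodMk continuousOn_id)
      fun t ht => ⟨trivial, ht.1, ht.2.trans_le (min_le_right _ _)⟩
  refine nonneg_of_le_of_neg_right hφcont hx₀ fun τ hτ hφτ => ?_
  have hτD : y τ ∈ D := hDC τ ⟨hτ.1, hτ.2.trans_le (min_le_right _ _)⟩ hφτ.ge
  -- The barrier condition is only known on `D`, so `ε` is a time for which `y` remains there.
  obtain ⟨ε, hε, hεD⟩ := Metric.mem_nhdsWithin_iff.1 (hycont τ hτ (hD.mem_nhds hτD))
  refine ⟨ε, hε, fun a e hτa hae heε heT hneg => ?_⟩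
  have hmem : ∀ {t}, t ∈ Icc a e → t ∈ Ico s (min t₁ s') := fun ht =>
    ⟨hτ.1.trans (hτa.le.trans ht.1), ht.2.trans_lt heT⟩
  have hmemD : ∀ t ∈ Icc a e, y t ∈ D := fun t ht => by
    refine hεD ⟨?_, hmem ht⟩
    rw [Metric.mem_ball, Real.dist_eq, abs_of_pos (sub_pos.2 (hτa.trans_le ht.1))]
    linarith [ht.2]
  have hIoo : Icc a e ⊆ Ioo s s' := fun t ht =>
    ⟨hτ.1.trans_lt (hτa.trans_le ht.1), (hmem ht).2.trans_le (min_le_right _ _)⟩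
  have hsub : Icc a e ⊆ Icc s t₁ := fun t ht => hIcc (hmem ht)
  refine AbsolutelyContinuousOnInterval.le_of_ae_hasDerivAt_nonneg hae
    (.comp_contDiffOn hb hae hIoo (hyac.mono ?_)) ?_
  · rw [uIcc_of_le hae]
    exact hsub.trans Icc_subset_uIcc
  filter_upwards [ae_restrict_of_ae_restrict_of_subset hsub hxF,
    ae_restrict_mem measurableSet_Icc] with t ⟨ζ, hζ, hd⟩ ht
  have ht0 : 0 ≤ t := hs.trans (hIoo ht).1.le
  have hyd : HasDerivAt y (groupPart cl k ζ) t :=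
    (groupPartCLM cl n k).hasFDerivAt.comp_hasDerivAt t hd
  have hbd : DifferentiableAt ℝ (fun p : GroupState n cl k × ℝ => b p.1 p.2) (y t, t) :=
    (hb.differentiableOn one_ne_zero).differentiableAt
      ((isOpen_univ.prod isOpen_Ioo).mem_nhds ⟨trivial, hIoo ht⟩)
  refine ⟨_, ?_, hasDerivAt_comp_curve hbd hyd⟩
  set d : FullState n → GroupState n cl k := fun w => groupPart cl k (fun i => c i w t) with hdd
  have hdcont : Continuous d := continuous_pi fun i => (hc i).continuous_left ht0
  have hnom : groupPart cl k ζ - d (x t) ∈ filippovMap (nominalLoop cl f g u k) (y t) t :=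
    map_sub_mem_filippovMap (groupPartCLM cl n k) (norm_groupPart_le cl k)
      (volume_preimage_groupPart_eq_zero cl k)
      (fun w => groupPart_closedLoop cl f g u c k w t) hdcont.continuousAt hζ
  have hlie := hbarrier (y t) (hmemD t ht) t (hIoo ht) _ ⟨_, hnom, rfl⟩
  have hgrad := (abs_le.1 (abs_fderiv_apply_le_gradNormOne_mul cl b (y t) t
    (d := d (x t)) fun i => hcC i i.2 (x t) t ht0)).1
  have hα0 : α (b (y t) t) < 0 := hα.map_zero ▸ hα.strictMono (hneg t ht)
  rw [map_sub] at hlie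
  -- The worst-case coupling term cancels the margin `gradNormOne * C`, leaving `φ' ≥ -α φ > 0`.
  linarith
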